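/- Let $\mathbb K$ be a field, let $n,t,s\ge 1$ be integers with $t\le n\le 2t$, and let $R=\mathbb K[x_1,\dots,x_n]$ with its standard grading. Let $L_n$ be the graph with vertices $x_1,\dots,x_n$ and edges $\{x_j,x_{j+1}\}$ for $1\le j\le n-1$, and let $I=I_t(L_n)\subseteq R$ be its $t$-path ideal, that is, the ideal generated by all products $x_{i_1}\cdots x_{i_t}$ of pairwise distinct vertices such that $\{x_{i_k},x_{i_{k+1}}\}$ is an edge for $1\le k\le t-1$. For $i\ge 0$ and $j\ge 0$, let $\beta_i(I^s)$ be the rank of the $i$-th free module in a minimal graded free resolution of $I^s$ over $R$, and let $\beta_{i,j}(I^s)$ be the number of elements of degree $j$ in a homogeneous basis of that module (a minimal graded free resolution exists and these numbers do not depend on its choice). Then for every $i\ge 0$ $$\beta_i(I^s)=\beta_{i,i+st}(I^s)=\sum_{k=i}^{n-t}\binom{n-t}{k}\binom{s}{k}\binom{k}{i},$$ where the sum is $0$ if $i>n-t$, and $\beta_{i,j}(I^s)=0$ for all $j\ne i+st$. In particular, the projective dimension of $R/I^s$ is $\operatorname{pd}_R R/I^s=\min\{n-t+1,\,s+1\}$.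 -/

import Mathlib

open CategoryTheory

/-- The `t`-path ideal of a simple graph `G` with vertex set `V`, in the polynomial ring over `K`
with one variable for each vertex: it is generated by the products `x_{p 0} ⋯ x_{p (t-1)}`, where
`p 0, …, p (t-1)` are pairwise distinct vertices and consecutive ones are joined by an edge. -/
noncomputable def pathIdeal (K : Type*) [Field K] {V : Type*} (G : SimpleGraph V) (t : ℕ) :
    Ideal (MvPolynomial V K) :=
  Ideal.span {f | ∃ p : Fin t → V, Function.Injective p ∧
    (∀ i j : Fin t, (i : ℕ) + 1 = (j : ℕ) → G.Adj (p i) (p j)) ∧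
    f = ∏ i, MvPolynomial.X (p i)}

/-- A minimal graded free resolution
`⋯ → F 2 → F 1 → F 0 → J → 0` of an ideal `J` of a standard graded polynomial ring `R` over a
field, where `F i = ⨁ b, R(-deg i b)` is graded free of finite rank `rk i`.
The degrees are natural numbers because `J` lives in nonnegative degrees, so that a basis
element of negative degree would violate minimality. -/
structure MinimalGradedFreeResolution {K : Type*} [Field K] {V : Type*}
    (J : Ideal (MvPolynomial V K)) where
  /-- The rank of `F i`. -/
  rk : ℕ → ℕ
  /-- The degrees of the elements of the standard basis of `F i`. -/
  deg : ∀ i, Fin (rk i) → ℕ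
  /-- The differential `F (i + 1) → F i`. -/
  d : ∀ i, (Fin (rk (i + 1)) → MvPolynomial V K) →ₗ[MvPolynomial V K]
    (Fin (rk i) → MvPolynomial V K)
  /-- The augmentation `F 0 → J ⊆ R`. -/
  aug : (Fin (rk 0) → MvPolynomial V K) →ₗ[MvPolynomial V K] MvPolynomial V K
  range_aug : LinearMap.range aug = J
  exact_aug : Function.Exact (d 0) aug
  exact_d : ∀ i, Function.Exact (d (i + 1)) (d i)
  /-- The augmentation preserves degrees. -/
  aug_homogeneous : ∀ b, (aug (Pi.single b 1)).IsHomogeneous (deg 0 b)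
  /-- The differentials preserve degrees: the matrix entry of `d i` in row `a` and column `b` is
  zero or homogeneous of degree `deg (i + 1) b - deg i a`. -/
  d_homogeneous : ∀ i b a, ∀ m ∈ (d i (Pi.single b 1) a).support,
    m.degree + deg i a = deg (i + 1) b
  /-- Minimality: the image of `d i` is contained in `𝔪 (F i)`, where the ideal `𝔪` generated
  by the variables consists of the polynomials with zero constant coefficient. -/
  minimal : ∀ i x a, MvPolynomial.constantCoeff (d i x a) = 0

namespace MinimalGradedFreeResolution

/-- The total Betti number `β_i`: the rank of the `i`-th free module. -/
def betti {K : Type*} [Field K] {V : Type*} {J : Ideal (MvPolynomial V K)}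
    (F : MinimalGradedFreeResolution J) (i : ℕ) : ℕ :=
  F.rk i

/-- The graded Betti number `β_{i,j}`: the number of basis elements of degree `j` in the `i`-th
free module. -/
def gradedBetti {K : Type*} [Field K] {V : Type*} {J : Ideal (MvPolynomial V K)}
    (F : MinimalGradedFreeResolution J) (i j : ℕ) : ℕ :=
  (Finset.univ.filter fun b => F.deg i b = j).card

end MinimalGradedFreeResolution

/-!
# The minimal resolution of the powers of the path ideals of a short path graph

Number the variables `x_0, …, x_{n-1}` and put `u_j = x_j x_{j+1} ⋯ x_{j+t-1}`. The `t`-path ideal of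
the path graph is generated by `u_0, …, u_{n-t}` (`pathIdeal_pathGraph`). Let `I_c` be the ideal of
`u_0, …, u_c`. Clearly `I_{c+1}^{s+1} = I_c^{s+1} + u_{c+1} I_{c+1}^s`, and if `c + 1 ≤ t` then

  `I_c^{s+1} ∩ u_{c+1} I_{c+1}^s = x_c u_{c+1} I_c^s`  (`rowIdeal_pow_inf`).

The nontrivial inclusion is a statement on monomials: if a product of `s + 1` of the `u_j` with
`j ≤ c` and `u_{c+1}` both divide a monomial `w`, drop from the product the factor which starts last;
what remains, times `x_c u_{c+1}`, still divides `w` (`exists_sum_pathExponent_le`). Only here the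
hypothesis `n ≤ 2 t` is used.

The intersection is generated one degree higher than the two summands. So if all three ideals have
linear resolutions, the mapping cone of a lift of the two inclusions is a linear resolution of
`I_{c+1}^{s+1}` (`LinearResolution.nonempty_sup`). By induction every `I_c^s` with `c ≤ t` has a
linear resolution (`nonempty_linearResolution_rowIdeal`), and its ranks satisfy
`b(c+1, s+1, i) = b(c, s+1, i) + b(c+1, s, i) + b(c, s, i-1)`, a recursion which the sum
`∑ k, (c.choose k) (s.choose k) (k.choose i)` solves (`pathBetti_succ_succ`).

A linear resolution is minimal. The Betti numbers are the same for all minimal graded resolutions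
(`MinimalGradedFreeResolution.betti_eq` and `MinimalGradedFreeResolution.gradedBetti_eq`): comparison
maps of degree zero are inverse to each other up to homotopy, hence inverse to each other modulo the
variables. Finally, the projective dimension of `R ⧸ J` is the length of a minimal resolution
(`MinimalGradedFreeResolution.projectiveDimension_quotient`), because otherwise its last differential
would split, although it vanishes modulo the variables.
-/

universe u v

/-! ### Homogeneous solutions and lifts -/

open MvPolynomial Matrix

namespace MvPolynomial

variable {σ R : Type*} [CommSemiring R]

theorem IsHomogeneous.homogeneousComponent_mul
    {p : MvPolynomial σ R} {m : ℕ} (hp : p.IsHomogeneous m) (q : MvPolynomial σ R) (e : ℕ) :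
    homogeneousComponent (m + e) (p * q) = p * homogeneousComponent e q := by
  conv_lhs => rw [← sum_homogeneousComponent q, Finset.mul_sum, map_sum]
  have key : ∀ i, homogeneousComponent (m + e) (p * homogeneousComponent i q) =
      if i = e then p * homogeneousComponent e q else 0 := by
    intro i
    rw [homogeneousComponent_of_mem
      ((mem_homogeneousSubmodule _ _).2 (hp.mul (homogeneousComponent_isHomogeneous i q)))]
    by_cases h : i = e
    · simp [h]
    · rw [if_neg h, if_neg (by omega)]
  simp only [key, Finset.sum_ite_eq', Finset.mem_range]
  split_ifs with h
  · rfl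
  · rw [homogeneousComponent_eq_zero _ _ (by omega), mul_zero]

theorem exists_add_eq_of_mem_support_sum_mul {ι : Type*} [Fintype ι]
    {p q : ι → MvPolynomial σ R} {m : σ →₀ ℕ} (hm : m ∈ (∑ c, p c * q c).support) :
    ∃ c, ∃ m₁ ∈ (p c).support, ∃ m₂ ∈ (q c).support, m₁ + m₂ = m := by
  classical
  obtain ⟨c, -, hc⟩ := Finset.mem_biUnion.1 (support_sum hm)
  obtain ⟨m₁, h₁, m₂, h₂, h⟩ := Finset.mem_add.1 (support_mul _ _ hc)
  exact ⟨c, m₁, h₁, m₂, h₂, h⟩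

theorem isHomogeneous_iff_degree {p : MvPolynomial σ R} {k : ℕ} :
    p.IsHomogeneous k ↔ ∀ m ∈ p.support, m.degree = k := by
  have h : ∀ m : σ →₀ ℕ, Finsupp.weight 1 m = m.degree := fun m => by
    rw [Finsupp.degree_eq_weight_one]
    rfl
  simp only [IsHomogeneous, IsWeightedHomogeneous, h, mem_support_iff]

/-- A solvable linear system which is homogeneous for given degrees `δ` of the rows and `ε` of the
columns, with homogeneous right-hand side, has a homogeneous solution. -/
theorem exists_graded_solution {κ ι : Type*} [Fintype ι]
    {M : κ → ι → MvPolynomial σ R} {δ : κ → ℕ} {ε : ι → ℕ} {y : κ → MvPolynomial σ R} {e : ℕ}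
    (hM : ∀ a b, ∀ m ∈ (M a b).support, m.degree + δ a = ε b)
    (hy : ∀ a, ∀ m ∈ (y a).support, m.degree + δ a = e)
    (h : ∃ x : ι → MvPolynomial σ R, ∀ a, ∑ b, M a b * x b = y a) :
    ∃ x : ι → MvPolynomial σ R, (∀ b, ∀ m ∈ (x b).support, m.degree + ε b = e) ∧
      ∀ a, ∑ b, M a b * x b = y a := by
  classical
  obtain ⟨x, hx⟩ := h
  have hM0 : ∀ a b, M a b = 0 ∨ δ a ≤ ε b ∧ (M a b).IsHomogeneous (ε b - δ a) := by
    intro a b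
    by_cases h0 : M a b = 0
    · exact Or.inl h0
    · obtain ⟨m, hm⟩ := support_nonempty.2 h0
      have h1 := hM a b m hm
      refine Or.inr ⟨by omega, isHomogeneous_iff_degree.2 fun m hm => ?_⟩
      have h2 := hM a b m hm
      omega
  refine ⟨fun b => if ε b ≤ e then homogeneousComponent (e - ε b) (x b) else 0,
    fun b m hm => ?_, fun a => ?_⟩
  · dsimp only at hm
    split_ifs at hm with hb
    · rw [mem_support_iff, coeff_homogeneousComponent, ne_eq, ite_eq_right_iff,
        Classical.not_imp] at hm
      omega
    · simp at hm
  · by_cases ha : δ a ≤ e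
    · have hya : (y a).IsHomogeneous (e - δ a) := by
        refine isHomogeneous_iff_degree.2 fun m hm => ?_
        have := hy a m hm
        omega
      rw [← homogeneousComponent_eq_self hya, ← hx a, map_sum]
      refine Finset.sum_congr rfl fun b _ => ?_
      rcases hM0 a b with h0 | ⟨hle, hhom⟩
      · simp [h0]
      dsimp only
      split_ifs with hb
      · rw [← hhom.homogeneousComponent_mul]
        congr 2
        omega
      · rw [mul_zero]
        ext m
        rw [coeff_homogeneousComponent, coeff_zero]
        split_ifs with hm
        · rw [coeff_mul]
          refine (Finset.sum_eq_zero fun k hk => ?_).symm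
          have hdeg : k.1.degree + k.2.degree = m.degree := by
            rw [← Finset.HasAntidiagonal.mem_antidiagonal.1 hk, map_add]
          rw [hhom.coeff_eq_zero (by omega), zero_mul]
        · rfl
    · have hy0 : y a = 0 := by
        rw [← support_eq_empty, Finset.eq_empty_iff_forall_notMem]
        intro m hm
        have := hy a m hm
        omega
      rw [hy0]
      refine Finset.sum_eq_zero fun b _ => ?_
      rcases hM0 a b with h0 | ⟨hle, -⟩
      · rw [h0, zero_mul]
      · dsimp only
        rw [if_neg (by omega), mul_zero]

/-- The special case of a system with coefficients of one degree. -/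
theorem exists_homogeneous_solution {κ ι : Type*} [Fintype ι]
    {M : κ → ι → MvPolynomial σ R} {y : κ → MvPolynomial σ R} {m e : ℕ}
    (hM : ∀ a b, (M a b).IsHomogeneous m) (hy : ∀ a, (y a).IsHomogeneous (m + e))
    (h : ∃ x : ι → MvPolynomial σ R, ∀ a, ∑ b, M a b * x b = y a) :
    ∃ x : ι → MvPolynomial σ R, (∀ b, (x b).IsHomogeneous e) ∧ ∀ a, ∑ b, M a b * x b = y a := by
  obtain ⟨x, hx, hxy⟩ := exists_graded_solution (δ := fun _ => 0) (ε := fun _ => m) (e := m + e)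
    (fun a b => isHomogeneous_iff_degree.1 (hM a b))
    (fun a => isHomogeneous_iff_degree.1 (hy a)) h
  refine ⟨x, fun b => isHomogeneous_iff_degree.2 fun k hk => ?_, hxy⟩
  have := hx b k hk
  omega

end MvPolynomial

/-- Dependent choice: a sequence with a given first term in which consecutive terms are related.
The predicate `Q` is what makes it possible to find the next term. -/
theorem exists_seq_of_forall_exists {X : ℕ → Type*} (Q : ∀ i, X i → Prop)
    (r : ∀ i, X i → X (i + 1) → Prop) (x₀ : X 0) (h₀ : Q 0 x₀)
    (hs : ∀ i x, Q i x → ∃ y, Q (i + 1) y ∧ r i x y) :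
    ∃ f : ∀ i, X i, f 0 = x₀ ∧ (∀ i, Q i (f i)) ∧ ∀ i, r i (f i) (f (i + 1)) := by
  choose g hg using hs
  let f : ∀ i, {x : X i // Q i x} := fun i =>
    Nat.rec ⟨x₀, h₀⟩ (fun i x => ⟨g i x.1 x.2, (hg i x.1 x.2).1⟩) i
  exact ⟨fun i => (f i).1, rfl, fun i => (f i).2, fun i => (hg i (f i).1 (f i).2).2⟩

theorem LinearMap.apply_eq_sum_single {R M ι : Type*} [CommSemiring R] [AddCommMonoid M]
    [Module R M] [Fintype ι] [DecidableEq ι] (f : (ι → R) →ₗ[R] M) (x : ι → R) :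
    f x = ∑ c, x c • f (Pi.single c 1) := by
  conv_lhs => rw [pi_eq_sum_univ' x, map_sum]
  refine Finset.sum_congr rfl fun c _ => ?_
  rw [map_smul]

/-- A linear map from a free module lifts if it does so on the basis; the values on the basis may
be prescribed. -/
theorem LinearMap.exists_lift_of_single {R M N ι : Type*} [CommSemiring R] [AddCommMonoid M]
    [Module R M] [AddCommMonoid N] [Module R N] [Fintype ι] [DecidableEq ι]
    (f : (ι → R) →ₗ[R] M) (g : N →ₗ[R] M) (P : ι → N → Prop)
    (h : ∀ b, ∃ y, P b y ∧ g y = f (Pi.single b 1)) :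
    ∃ φ : (ι → R) →ₗ[R] N, (∀ b, P b (φ (Pi.single b 1))) ∧ ∀ x, g (φ x) = f x := by
  choose y hP hy using h
  have hφ : ∀ b, (Pi.basisFun R ι).constr R y (Pi.single b 1) = y b := fun b => by
    rw [← Pi.basisFun_apply, Module.Basis.constr_basis]
  refine ⟨(Pi.basisFun R ι).constr R y, fun b => (hφ b).symm ▸ hP b, fun x => ?_⟩
  rw [LinearMap.apply_eq_sum_single _ x, LinearMap.apply_eq_sum_single f x, map_sum]
  refine Finset.sum_congr rfl fun c _ => ?_
  rw [map_smul, hφ, hy]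

/-! ### Linear resolutions and mapping cones -/

/-- A linear resolution of an ideal `J` generated in degree `D`, with ranks `r 0, r 1, …`: a graded
free resolution whose `i`-th module is generated in degree `D + i`. The differentials are given by
matrices; up to a choice of basis the grading then says that the augmentation has entries
homogeneous of degree `D` and all the differentials have entries which are linear forms. The bases
are indexed by arbitrary finite types, so that direct sums of resolutions are easy to form. -/
structure LinearResolution {K : Type*} [Field K] {σ : Type*} (J : Ideal (MvPolynomial σ K))
    (D : ℕ) (r : ℕ → ℕ) where
  /-- The index type of the basis of the `i`-th free module. -/
  ι : ℕ → Type
  [fintype : ∀ i, Fintype (ι i)]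
  card_eq : ∀ i, Fintype.card (ι i) = r i
  /-- The augmentation, as a row vector. -/
  aug : ι 0 → MvPolynomial σ K
  /-- The matrix of the differential from the `(i + 1)`-st to the `i`-th free module. -/
  d : ∀ i, Matrix (ι i) (ι (i + 1)) (MvPolynomial σ K)
  aug_homogeneous : ∀ b, (aug b).IsHomogeneous D
  d_homogeneous : ∀ i a b, (d i a b).IsHomogeneous 1
  mem_iff : ∀ f, f ∈ J ↔ ∃ x, aug ⬝ᵥ x = f
  exact_aug : ∀ x, aug ⬝ᵥ x = 0 ↔ ∃ y, d 0 *ᵥ y = x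
  exact_d : ∀ i x, d i *ᵥ x = 0 ↔ ∃ y, d (i + 1) *ᵥ y = x

namespace LinearResolution

attribute [instance] LinearResolution.fintype

variable {K : Type*} [Field K] {σ : Type*} {J A B C : Ideal (MvPolynomial σ K)}
  {D : ℕ} {r a b c : ℕ → ℕ}

theorem d_mulVec_d_mulVec (F : LinearResolution J D r) (i : ℕ) (y) :
    F.d i *ᵥ (F.d (i + 1) *ᵥ y) = 0 := (F.exact_d i _).2 ⟨y, rfl⟩

theorem aug_dotProduct_d_mulVec (F : LinearResolution J D r) (y) :
    F.aug ⬝ᵥ (F.d 0 *ᵥ y) = 0 := (F.exact_aug _).2 ⟨y, rfl⟩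

/-- The index types of the bases in the resolution of a nonzero principal ideal: one basis element in
homological degree `0` and none above. -/
def PrincipalIndex : ℕ → Type
  | 0 => Unit
  | _ + 1 => Empty

instance : ∀ i, Fintype (PrincipalIndex i)
  | 0 => inferInstanceAs (Fintype Unit)
  | _ + 1 => inferInstanceAs (Fintype Empty)

/-- A nonzero principal ideal is free of rank one. -/
noncomputable def ofSpanSingleton {f : MvPolynomial σ K} (hf : f ≠ 0) (hD : f.IsHomogeneous D) :
    LinearResolution (Ideal.span {f}) D (fun i => if i = 0 then 1 else 0) where
  ι := PrincipalIndex
  card_eq i := by cases i <;> rfl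
  aug := fun _ => f
  d := fun _ => 0
  aug_homogeneous _ := hD
  d_homogeneous _ _ _ := isHomogeneous_zero _ _ _
  mem_iff g := by
    rw [Ideal.mem_span_singleton']
    constructor
    · rintro ⟨x, rfl⟩
      exact ⟨fun _ => x, (Fintype.sum_unique (ι := Unit) _).trans (mul_comm _ _)⟩
    · rintro ⟨x, rfl⟩
      exact ⟨x (), (mul_comm _ _).trans (Fintype.sum_unique (ι := Unit) fun u => f * x u).symm⟩
  exact_aug x := by
    have : (fun _ => f) ⬝ᵥ x = f * x () := Fintype.sum_unique (ι := Unit) _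
    rw [this, mul_eq_zero, or_iff_right hf]
    simp only [zero_mulVec, exists_const]
    exact ⟨fun h => funext fun _ => h.symm, fun h => (congrFun h ()).symm⟩
  exact_d i x := by
    have : IsEmpty (PrincipalIndex (i + 1)) := inferInstanceAs (IsEmpty Empty)
    simp [Subsingleton.elim x 0]

/-- Multiplication by a nonzero form of degree `e` shifts a linear resolution by `e`. -/
noncomputable def smul (F : LinearResolution J D r) {f : MvPolynomial σ K} {e : ℕ} (hf : f ≠ 0)
    (he : f.IsHomogeneous e) : LinearResolution (Ideal.span {f} * J) (e + D) r where
  ι := F.ι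
  card_eq := F.card_eq
  aug := f • F.aug
  d := F.d
  aug_homogeneous b := he.mul (F.aug_homogeneous b)
  d_homogeneous := F.d_homogeneous
  mem_iff g := by
    simp only [Ideal.mem_span_singleton_mul, F.mem_iff, smul_dotProduct, smul_eq_mul]
    constructor
    · rintro ⟨_, ⟨x, rfl⟩, rfl⟩
      exact ⟨x, rfl⟩
    · rintro ⟨x, rfl⟩
      exact ⟨_, ⟨x, rfl⟩, rfl⟩
  exact_aug x := by
    rw [smul_dotProduct, smul_eq_mul, mul_eq_zero, or_iff_right hf, F.exact_aug]
  exact_d := F.exact_d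

/-- An inclusion of an ideal generated in degree `D + 1` into one generated in degree `D` lifts to
a chain map of linear resolutions whose matrices have linear entries. -/
theorem exists_chainMap (F : LinearResolution A D a) (G : LinearResolution C (D + 1) c)
    (h : C ≤ A) : ∃ α : ∀ i, Matrix (F.ι i) (G.ι i) (MvPolynomial σ K),
      (∀ i p q, (α i p q).IsHomogeneous 1) ∧ (∀ z, F.aug ⬝ᵥ (α 0 *ᵥ z) = G.aug ⬝ᵥ z) ∧
      ∀ i z, F.d i *ᵥ (α (i + 1) *ᵥ z) = α i *ᵥ (G.d i *ᵥ z) := by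
  classical
  -- `α 0`, column by column
  have h0 : ∀ q, ∃ x : F.ι 0 → MvPolynomial σ K, (∀ p, (x p).IsHomogeneous 1) ∧
      F.aug ⬝ᵥ x = G.aug q := by
    intro q
    obtain ⟨x, hx⟩ := (F.mem_iff _).1 (h ((G.mem_iff _).2 ⟨Pi.single q 1, rfl⟩))
    rw [dotProduct_single, mul_one] at hx
    obtain ⟨x, hx1, hx2⟩ := exists_homogeneous_solution (κ := Unit) (M := fun _ => F.aug)
      (y := fun _ => G.aug q) (m := D) (e := 1) (fun _ => F.aug_homogeneous)
      (fun _ => G.aug_homogeneous q) ⟨x, fun _ => hx⟩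
    exact ⟨x, hx1, hx2 ()⟩
  choose x hx1 hx2 using h0
  have hcol : ∀ z, F.aug ⬝ᵥ (Matrix.of (fun p q => x q p) *ᵥ z) = G.aug ⬝ᵥ z := by
    intro z
    rw [dotProduct_mulVec]
    congr 1
    ext1 q
    exact hx2 q
  obtain ⟨α, h0, hQ, hr⟩ := exists_seq_of_forall_exists
    (X := fun i => Matrix (F.ι i) (G.ι i) (MvPolynomial σ K))
    (fun i α => (∀ p q, (α p q).IsHomogeneous 1) ∧ ∀ z, ∃ y, F.d i *ᵥ y = α *ᵥ (G.d i *ᵥ z))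
    (fun i α β => ∀ z, F.d i *ᵥ (β *ᵥ z) = α *ᵥ (G.d i *ᵥ z))
    (Matrix.of (fun p q => x q p)) ⟨fun p q => hx1 q p, fun z => by
      rw [← F.exact_aug, hcol, G.aug_dotProduct_d_mulVec]⟩ (by
    rintro i α ⟨hα, hz⟩
    have hq : ∀ q, ∃ x : F.ι (i + 1) → MvPolynomial σ K, (∀ p, (x p).IsHomogeneous 1) ∧
        F.d i *ᵥ x = (α * G.d i).col q := by
      intro q
      obtain ⟨x, hx⟩ := hz (Pi.single q 1)
      rw [mulVec_mulVec, mulVec_single_one] at hx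
      obtain ⟨x, hx1, hx2⟩ := exists_homogeneous_solution (M := F.d i)
        (y := (α * G.d i).col q) (m := 1) (e := 1) (F.d_homogeneous i)
        (fun p => IsHomogeneous.sum _ _ _ fun k _ => (hα p k).mul (G.d_homogeneous i k q))
        ⟨x, fun p => congrFun hx p⟩
      exact ⟨x, hx1, funext hx2⟩
    choose x hx1 hx2 using hq
    have hβ : ∀ z, F.d i *ᵥ (Matrix.of (fun p q => x q p) *ᵥ z) = α *ᵥ (G.d i *ᵥ z) := by
      intro z
      rw [mulVec_mulVec, mulVec_mulVec]
      congr 1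
      ext p q
      exact congrArg (fun v => coeff _ (v p)) (hx2 q)
    refine ⟨Matrix.of (fun p q => x q p), ⟨fun p q => hx1 q p, fun z => ?_⟩, hβ⟩
    rw [← F.exact_d, hβ, G.d_mulVec_d_mulVec, mulVec_zero])
  exact ⟨α, fun i => (hQ i).1, h0 ▸ hcol, hr⟩

/-- The index types of a complex shifted by one homological degree. -/
def ShiftIndex (ι : ℕ → Type) : ℕ → Type
  | 0 => Empty
  | i + 1 => ι i

instance (ι : ℕ → Type) [∀ i, Fintype (ι i)] : ∀ i, Fintype (ShiftIndex ι i)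
  | 0 => inferInstanceAs (Fintype Empty)
  | i + 1 => inferInstanceAs (Fintype (ι i))

/-- The sequence of ranks of a complex shifted by one homological degree. -/
def shiftRank (c : ℕ → ℕ) : ℕ → ℕ
  | 0 => 0
  | i + 1 => c i

/-- The differential of the shifted complex: that of the complex itself, and zero in the lowest
degree. -/
noncomputable def shiftD (G : LinearResolution C D c) :
    ∀ i, Matrix (ShiftIndex G.ι i) (G.ι i) (MvPolynomial σ K)
  | 0 => Matrix.of fun x => x.elim
  | i + 1 => G.d i

/-- The differential of the mapping cone of `(α, -β) : G → F ⊕ F'`. -/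
noncomputable def coneD (F : LinearResolution A D a) (F' : LinearResolution B D b)
    (G : LinearResolution C (D + 1) c) (α : ∀ i, Matrix (F.ι i) (G.ι i) (MvPolynomial σ K))
    (β : ∀ i, Matrix (F'.ι i) (G.ι i) (MvPolynomial σ K)) (i : ℕ) :
    Matrix (F.ι i ⊕ F'.ι i ⊕ ShiftIndex G.ι i) (F.ι (i + 1) ⊕ F'.ι (i + 1) ⊕ G.ι i)
      (MvPolynomial σ K) :=
  fromBlocks (F.d i) (fromCols 0 (α i)) 0 (fromBlocks (F'.d i) (-β i) 0 (-G.shiftD i))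

theorem coneD_mulVec (F : LinearResolution A D a) (F' : LinearResolution B D b)
    (G : LinearResolution C (D + 1) c) (α : ∀ i, Matrix (F.ι i) (G.ι i) (MvPolynomial σ K))
    (β : ∀ i, Matrix (F'.ι i) (G.ι i) (MvPolynomial σ K)) (i : ℕ) (x) (y) (z) :
    coneD F F' G α β i *ᵥ Sum.elim x (Sum.elim y z) =
      Sum.elim (F.d i *ᵥ x + α i *ᵥ z)
        (Sum.elim (F'.d i *ᵥ y - β i *ᵥ z) (-(G.shiftD i *ᵥ z))) := by
  simp [coneD, fromBlocks_mulVec, fromCols_mulVec, neg_mulVec, sub_eq_add_neg]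

theorem exists_eq_elim {α β γ R : Type*} (v : α ⊕ β ⊕ γ → R) :
    ∃ x y z, v = Sum.elim x (Sum.elim y z) :=
  ⟨v ∘ Sum.inl, v ∘ Sum.inr ∘ Sum.inl, v ∘ Sum.inr ∘ Sum.inr, by
    ext (_ | _ | _) <;> rfl⟩

theorem elim_eq_elim_iff {α β γ R : Type*} {x x' : α → R} {y y' : β → R} {z z' : γ → R} :
    Sum.elim x (Sum.elim y z) = Sum.elim x' (Sum.elim y' z') ↔ x = x' ∧ y = y' ∧ z = z' := by
  constructor
  · intro h
    exact ⟨funext fun i => congrFun h (.inl i), funext fun i => congrFun h (.inr (.inl i)),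
      funext fun i => congrFun h (.inr (.inr i))⟩
  · rintro ⟨rfl, rfl, rfl⟩
    rfl

theorem elim_eq_zero_iff {α β γ R : Type*} [Zero R] {x : α → R} {y : β → R} {z : γ → R} :
    Sum.elim x (Sum.elim y z) = 0 ↔ x = 0 ∧ y = 0 ∧ z = 0 := by
  rw [← elim_eq_elim_iff]
  simp only [Sum.elim_zero_zero]

theorem shiftD_mulVec_d_mulVec (G : LinearResolution C D c) (i : ℕ) (y) :
    G.shiftD i *ᵥ (G.d i *ᵥ y) = 0 := by
  cases i with
  | zero => exact funext fun x => x.elim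
  | succ i => exact G.d_mulVec_d_mulVec i y

/-- If `A ∩ B` is generated one degree higher than `A` and `B` and all three have linear
resolutions, then the mapping cone resolving `A + B` is linear too. -/
theorem nonempty_sup (F : LinearResolution A D a) (F' : LinearResolution B D b)
    (G : LinearResolution C (D + 1) c) (hC : A ⊓ B = C) :
    Nonempty (LinearResolution (A ⊔ B) D (fun i => a i + (b i + shiftRank c i))) := by
  obtain ⟨α, hα1, hα0, hα⟩ := F.exists_chainMap G (hC ▸ inf_le_left)
  obtain ⟨β, hβ1, hβ0, hβ⟩ := F'.exists_chainMap G (hC ▸ inf_le_right)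
  have hempty (z : ShiftIndex G.ι 0 → MvPolynomial σ K) : z = 0 := funext fun x => x.elim
  have haug (x y z) : Sum.elim F.aug (Sum.elim F'.aug (fun x : ShiftIndex G.ι 0 => x.elim)) ⬝ᵥ
      Sum.elim x (Sum.elim y z) = F.aug ⬝ᵥ x + F'.aug ⬝ᵥ y := by
    rw [sumElim_dotProduct_sumElim, sumElim_dotProduct_sumElim, hempty z, dotProduct_zero,
      add_zero]
  refine ⟨{
    ι := fun i => F.ι i ⊕ F'.ι i ⊕ ShiftIndex G.ι i
    card_eq := fun i => ?_
    aug := Sum.elim F.aug (Sum.elim F'.aug (fun x => x.elim))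
    d := fun i => coneD F F' G α β i
    aug_homogeneous := ?_
    d_homogeneous := ?_
    mem_iff := fun f => ?_
    exact_aug := fun v => ?_
    exact_d := fun i v => ?_ }⟩
  · rw [Fintype.card_sum, Fintype.card_sum, F.card_eq, F'.card_eq]
    congr 2
    cases i
    · rfl
    · exact G.card_eq _
  · rintro (b | b | b)
    · exact F.aug_homogeneous b
    · exact F'.aug_homogeneous b
    · exact b.elim
  · rintro i (a | a | a) (b | b | b)
    · exact F.d_homogeneous i a b
    · exact isHomogeneous_zero _ _ _
    · exact hα1 i a b
    · exact isHomogeneous_zero _ _ _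
    · exact F'.d_homogeneous i a b
    · exact (hβ1 i a b).neg
    · exact isHomogeneous_zero _ _ _
    · exact isHomogeneous_zero _ _ _
    · cases i with
      | zero => exact a.elim
      | succ i => exact (G.d_homogeneous i a b).neg
  · rw [Submodule.mem_sup]
    constructor
    · rintro ⟨g, hg, h, hh, rfl⟩
      obtain ⟨x, rfl⟩ := (F.mem_iff _).1 hg
      obtain ⟨y, rfl⟩ := (F'.mem_iff _).1 hh
      exact ⟨Sum.elim x (Sum.elim y 0), haug x y 0⟩
    · rintro ⟨v, rfl⟩
      obtain ⟨x, y, z, rfl⟩ := exists_eq_elim v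
      rw [haug]
      exact ⟨_, (F.mem_iff _).2 ⟨x, rfl⟩, _, (F'.mem_iff _).2 ⟨y, rfl⟩, rfl⟩
  · obtain ⟨x, y, z, rfl⟩ := exists_eq_elim v
    rw [haug]
    constructor
    · intro h
      have hx : F.aug ⬝ᵥ x ∈ C := by
        rw [← hC]
        refine ⟨(F.mem_iff _).2 ⟨x, rfl⟩, ?_⟩
        rw [eq_neg_of_add_eq_zero_left h]
        exact B.neg_mem ((F'.mem_iff _).2 ⟨y, rfl⟩)
      obtain ⟨w, hw⟩ := (G.mem_iff _).1 hx
      obtain ⟨x', hx'⟩ := (F.exact_aug (x - α 0 *ᵥ w)).1 (by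
        rw [dotProduct_sub, hα0, hw, sub_self])
      obtain ⟨y', hy'⟩ := (F'.exact_aug (y + β 0 *ᵥ w)).1 (by
        rw [dotProduct_add, hβ0, hw, add_comm, h])
      refine ⟨Sum.elim x' (Sum.elim y' w), ?_⟩
      erw [coneD_mulVec]
      rw [hx', hy', sub_add_cancel, add_sub_cancel_right, hempty z, hempty (-_)]
    · rintro ⟨v, hv⟩
      obtain ⟨x', y', w, rfl⟩ := exists_eq_elim v
      erw [coneD_mulVec] at hv
      obtain ⟨rfl, rfl, -⟩ := elim_eq_elim_iff.1 hv
      rw [dotProduct_add, dotProduct_sub, F.aug_dotProduct_d_mulVec, F'.aug_dotProduct_d_mulVec]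
      erw [hα0, hβ0]
      ring
  · obtain ⟨x, y, z, rfl⟩ := exists_eq_elim v
    change G.ι i → MvPolynomial σ K at z
    constructor
    · intro h
      erw [coneD_mulVec, elim_eq_zero_iff, neg_eq_zero] at h
      obtain ⟨h1, h2, h3⟩ := h
      -- the component `z` is a boundary up to sign; for `i = 0` this is exactness at the
      -- augmentation of `C`
      obtain ⟨w, rfl⟩ : ∃ w, G.d i *ᵥ w = z := by
        cases i with
        | zero =>
          have h4 := F.aug_dotProduct_d_mulVec x
          rw [eq_neg_of_add_eq_zero_left h1, dotProduct_neg, hα0, neg_eq_zero] at h4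
          exact (G.exact_aug z).1 h4
        | succ i => exact (G.exact_d i z).1 h3
      obtain ⟨x', hx'⟩ := (F.exact_d i (x + α (i + 1) *ᵥ w)).1 (by
        rw [mulVec_add, hα, h1])
      obtain ⟨y', hy'⟩ := (F'.exact_d i (y - β (i + 1) *ᵥ w)).1 (by
        rw [mulVec_sub, hβ, h2])
      refine ⟨Sum.elim x' (Sum.elim y' (-w)), ?_⟩
      erw [coneD_mulVec]
      refine elim_eq_elim_iff.2 ⟨?_, ?_, ?_⟩
      · rw [hx', mulVec_neg, add_neg_cancel_right]
      · rw [hy', mulVec_neg, sub_neg_eq_add, sub_add_cancel]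
      · rw [mulVec_neg, neg_neg]
        rfl
    · rintro ⟨v, hv⟩
      obtain ⟨x', y', w, rfl⟩ := exists_eq_elim v
      erw [coneD_mulVec] at hv
      obtain ⟨rfl, rfl, rfl⟩ := elim_eq_elim_iff.1 hv
      change G.ι (i + 1) → MvPolynomial σ K at w
      have h1 : F.d i *ᵥ (F.d (i + 1) *ᵥ x' + α (i + 1) *ᵥ w) + α i *ᵥ (-(G.d i *ᵥ w)) = 0 := by
        rw [mulVec_add, F.d_mulVec_d_mulVec, hα, mulVec_neg, zero_add, add_neg_cancel]
      have h2 : F'.d i *ᵥ (F'.d (i + 1) *ᵥ y' - β (i + 1) *ᵥ w) - β i *ᵥ (-(G.d i *ᵥ w)) = 0 := by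
        rw [mulVec_sub, F'.d_mulVec_d_mulVec, hβ, mulVec_neg, zero_sub, sub_neg_eq_add,
          neg_add_cancel]
      have h3 : -(G.shiftD i *ᵥ (-(G.d i *ᵥ w))) = 0 := by
        rw [mulVec_neg, neg_neg, G.shiftD_mulVec_d_mulVec i w]
      erw [coneD_mulVec]
      exact elim_eq_zero_iff.2 ⟨h1, h2, h3⟩

theorem constantCoeff_d_mulVec (F : LinearResolution J D r) (i : ℕ) (x) (p) :
    constantCoeff ((F.d i *ᵥ x) p) = 0 := by
  rw [mulVec, dotProduct, map_sum]
  refine Finset.sum_eq_zero fun q _ => ?_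
  rw [map_mul, constantCoeff_eq, (F.d_homogeneous i p q).coeff_eq_zero (by simp), zero_mul]

/-- A linear resolution is minimal, because linear forms have no constant term. -/
noncomputable def toMinimal (F : LinearResolution J D r) : MinimalGradedFreeResolution J :=
  let e : ∀ i, F.ι i ≃ Fin (r i) := fun i => Fintype.equivFinOfCardEq (F.card_eq i)
  have hd : ∀ i x, mulVecLin ((F.d i).submatrix (e i).symm (e (i + 1)).symm) x =
      (F.d i *ᵥ (x ∘ e (i + 1))) ∘ (e i).symm := fun i x => by
    rw [mulVecLin_apply, submatrix_mulVec_equiv, Equiv.symm_symm]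
  have haug : ∀ x, (F.aug ∘ (e 0).symm) ⬝ᵥ x = F.aug ⬝ᵥ (x ∘ e 0) := fun x =>
    comp_equiv_symm_dotProduct _ _ _
  { rk := r
    deg := fun i _ => i + D
    d := fun i => mulVecLin ((F.d i).submatrix (e i).symm (e (i + 1)).symm)
    aug :=
      { toFun := fun x => (F.aug ∘ (e 0).symm) ⬝ᵥ x
        map_add' := dotProduct_add _
        map_smul' := fun k => dotProduct_smul k _ }
    range_aug := by
      ext f
      rw [F.mem_iff, LinearMap.mem_range]
      simp only [LinearMap.coe_mk, AddHom.coe_mk, haug]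
      exact ⟨fun ⟨x, hx⟩ => ⟨_, hx⟩, fun ⟨x, hx⟩ => ⟨x ∘ (e 0).symm, by
        rw [Function.comp_assoc, Equiv.symm_comp_self, Function.comp_id, hx]⟩⟩
    exact_aug := fun x => by
      simp only [LinearMap.coe_mk, AddHom.coe_mk, haug, F.exact_aug, Set.mem_range, hd,
        Equiv.comp_symm_eq]
      exact ⟨fun ⟨y, hy⟩ => ⟨y ∘ (e 1).symm, by
        rw [Function.comp_assoc, Equiv.symm_comp_self, Function.comp_id, hy]⟩,
        fun ⟨y, hy⟩ => ⟨_, hy⟩⟩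
    exact_d := fun i x => by
      have h0 : (0 : Fin (r i) → MvPolynomial σ K) ∘ e i = 0 := rfl
      simp only [hd, Equiv.comp_symm_eq, h0, F.exact_d, Set.mem_range]
      exact ⟨fun ⟨y, hy⟩ => ⟨y ∘ (e (i + 2)).symm, by
        rw [Function.comp_assoc, Equiv.symm_comp_self, Function.comp_id, hy]⟩,
        fun ⟨y, hy⟩ => ⟨_, hy⟩⟩
    aug_homogeneous := fun b => by
      simp only [LinearMap.coe_mk, AddHom.coe_mk, dotProduct_single, mul_one, zero_add]
      exact F.aug_homogeneous _
    d_homogeneous := fun i b a m hm => by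
      rw [mulVecLin_apply, mulVec_single_one, mem_support_iff] at hm
      have : m.degree = 1 := by
        by_contra h
        exact hm ((F.d_homogeneous i _ _).coeff_eq_zero h)
      omega
    minimal := fun i x a => by
      rw [hd]
      exact F.constantCoeff_d_mulVec i _ _ }

end LinearResolution

/-! ### The recursion for the ranks -/

/-- The expected `i`-th Betti number of the `s`-th power of the ideal of a row of `c + 1`
consecutive paths, with the sum extended by the vanishing terms `l < i`. -/
def pathBetti (c s i : ℕ) : ℕ :=
  ∑ l ∈ Finset.range (c + 1), c.choose l * s.choose l * l.choose i

theorem pathBetti_zero_left (s i : ℕ) : pathBetti 0 s i = if i = 0 then 1 else 0 := by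
  cases i <;> simp [pathBetti]

theorem pathBetti_zero_right (c i : ℕ) : pathBetti c 0 i = if i = 0 then 1 else 0 := by
  rw [pathBetti, Finset.sum_range_succ']
  cases i <;> simp

theorem pathBetti_eq_sum_Icc (c s i : ℕ) :
    pathBetti c s i = ∑ k ∈ Finset.Icc i c, c.choose k * s.choose k * k.choose i := by
  symm
  refine Finset.sum_subset (fun k hk => ?_) (fun k hk hk' => ?_)
  · simp only [Finset.mem_Icc, Finset.mem_range] at *
    omega
  · simp only [Finset.mem_Icc, Finset.mem_range] at *
    rw [Nat.choose_eq_zero_of_lt (by omega : k < i), mul_zero]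

theorem pathBetti_pos_iff (c s i : ℕ) : 0 < pathBetti c s i ↔ i ≤ c ∧ i ≤ s := by
  rw [pathBetti, Finset.sum_pos_iff]
  simp only [Finset.mem_range, Nat.pos_iff_ne_zero, ne_eq, mul_eq_zero, not_or,
    Nat.choose_eq_zero_iff, not_lt]
  constructor
  · rintro ⟨k, hk⟩
    omega
  · rintro ⟨h1, h2⟩
    exact ⟨i, by omega⟩

theorem pathBetti_succ_succ (c s i : ℕ) : pathBetti (c + 1) (s + 1) i =
    pathBetti c (s + 1) i +
      (pathBetti (c + 1) s i + LinearResolution.shiftRank (pathBetti c s) i) := by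
  have h1 : ∀ s, pathBetti c s i =
      ∑ l ∈ Finset.range (c + 1), c.choose (l + 1) * s.choose (l + 1) * (l + 1).choose i +
        (0 : ℕ).choose i := by
    intro s
    have := Finset.sum_range_succ (fun l => c.choose l * s.choose l * l.choose i) (c + 1)
    rw [Nat.choose_succ_self, zero_mul, zero_mul, add_zero] at this
    rw [pathBetti, ← this, Finset.sum_range_succ']
    simp
  have h2 : ∀ s, pathBetti (c + 1) s i =
      ∑ l ∈ Finset.range (c + 1), (c + 1).choose (l + 1) * s.choose (l + 1) * (l + 1).choose i +
        (0 : ℕ).choose i := by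
    intro s
    rw [pathBetti, Finset.sum_range_succ']
    simp
  have h3 : pathBetti c s i + LinearResolution.shiftRank (pathBetti c s) i =
      ∑ l ∈ Finset.range (c + 1), c.choose l * s.choose l * (l + 1).choose i := by
    cases i with
    | zero => simp [LinearResolution.shiftRank, pathBetti]
    | succ i =>
      simp only [LinearResolution.shiftRank, pathBetti, ← Finset.sum_add_distrib,
        Nat.choose_succ_succ' _ i]
      exact Finset.sum_congr rfl fun l _ => by ring
  have h4 : pathBetti (c + 1) (s + 1) i + pathBetti c s i = pathBetti c (s + 1) i +
      pathBetti (c + 1) s i +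
        (pathBetti c s i + LinearResolution.shiftRank (pathBetti c s) i) := by
    rw [h3, h1, h1, h2, h2, add_add_add_comm, ← Finset.sum_add_distrib, add_add_add_comm,
      ← Finset.sum_add_distrib, add_right_comm, ← Finset.sum_add_distrib]
    congr 1
    refine Finset.sum_congr rfl fun l _ => ?_
    rw [Nat.choose_succ_succ' c, Nat.choose_succ_succ' s]
    ring
  omega

/-! ### Powers of the ideal of a row of paths -/

/-- The powers of an ideal generated by monomials. -/
theorem MvPolynomial.span_monomial_pow {R σ ι : Type*} [CommSemiring R] (u : ι → σ →₀ ℕ)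
    (S : Set ι) (s : ℕ) :
    Ideal.span ((fun j => monomial (u j) (1 : R)) '' S) ^ s =
      Ideal.span ((fun e => monomial e (1 : R)) ''
        {e | ∃ a : Multiset ι, a.card = s ∧ (∀ j ∈ a, j ∈ S) ∧ (a.map u).sum = e}) := by
  induction s with
  | zero =>
    rw [pow_zero, Ideal.one_eq_top, eq_comm, Ideal.eq_top_iff_one]
    exact Ideal.subset_span ⟨0, ⟨0, by simp⟩, rfl⟩
  | succ s ih =>
    rw [pow_succ, ih, Ideal.span_mul_span']
    congr 1
    ext f
    simp only [Set.mem_mul, Set.mem_image, Set.mem_ofPred_eq]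
    constructor
    · rintro ⟨_, ⟨_, ⟨a, ha, hS, rfl⟩, rfl⟩, _, ⟨j, hj, rfl⟩, rfl⟩
      refine ⟨_, ⟨j ::ₘ a, by simp [ha], by simpa using ⟨hj, hS⟩, rfl⟩, ?_⟩
      rw [monomial_mul, Multiset.map_cons, Multiset.sum_cons, add_comm, mul_one]
    · rintro ⟨_, ⟨a, ha, hS, rfl⟩, rfl⟩
      obtain ⟨j, a, rfl⟩ := Multiset.exists_mem_of_ne_zero (s := a) (by
        rintro rfl
        simp at ha) |>.imp fun j hj => Multiset.exists_cons_of_mem hj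
      refine ⟨_, ⟨_, ⟨a, by simpa using ha, fun k hk => hS k (Multiset.mem_cons_of_mem hk), rfl⟩,
        rfl⟩, _, ⟨j, hS j (Multiset.mem_cons_self _ _), rfl⟩, ?_⟩
      rw [monomial_mul, Multiset.map_cons, Multiset.sum_cons, add_comm, mul_one]

theorem Ideal.sup_pow_succ {R : Type*} [CommSemiring R] (A B : Ideal R) (s : ℕ) :
    (A ⊔ B) ^ (s + 1) = A ^ (s + 1) ⊔ B * (A ⊔ B) ^ s := by
  induction s with
  | zero => simp
  | succ s ih =>
    refine le_antisymm ?_ (sup_le (Ideal.pow_right_mono le_sup_left _) ?_)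
    · rw [pow_succ', Ideal.sup_mul]
      refine sup_le ?_ le_sup_right
      conv_lhs => rw [ih]
      rw [Ideal.mul_sup, ← pow_succ' A (s + 1)]
      refine sup_le_sup_left ?_ _
      rw [mul_left_comm, pow_succ' (A ⊔ B) s]
      exact Ideal.mul_mono_right (Ideal.mul_mono_left le_sup_left)
    · rw [pow_succ' (A ⊔ B) (s + 1)]
      exact Ideal.mul_mono_left le_sup_right

/-- The exponent of the monomial `x_j x_{j+1} ⋯ x_{j+t-1}`, where the variables are numbered from
`0` to `n - 1`. The factors `x_p` with `p ≥ n` are left out, so that it stands for a path only if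
`j + t ≤ n`. -/
noncomputable def pathExponent (n t j : ℕ) : Fin n →₀ ℕ :=
  Finsupp.equivFunOnFinite.symm fun p => if j ≤ p ∧ (p : ℕ) < j + t then 1 else 0

theorem pathExponent_apply (n t j : ℕ) (p : Fin n) :
    pathExponent n t j p = if j ≤ p ∧ (p : ℕ) < j + t then 1 else 0 := rfl

theorem degree_pathExponent {n t j : ℕ} (h : j + t ≤ n) : (pathExponent n t j).degree = t := by
  rw [Finsupp.degree_eq_sum]
  simp only [pathExponent_apply, Finset.sum_boole, Nat.cast_id]
  have : (Finset.univ.filter fun p : Fin n => j ≤ p ∧ (p : ℕ) < j + t).map Fin.valEmbedding =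
      Finset.Ico j (j + t) := by
    ext p
    simp only [Finset.mem_map, Finset.mem_filter, Finset.mem_univ, true_and,
      Fin.valEmbedding_apply, Finset.mem_Ico]
    exact ⟨by rintro ⟨p, hp, rfl⟩; exact hp, fun hp => ⟨⟨p, by omega⟩, hp, rfl⟩⟩
  rw [← Finset.card_map, this, Nat.card_Ico, add_tsub_cancel_left]

/-- The ideal generated by the monomials of the first `c + 1` paths with `t` vertices. -/
noncomputable def rowIdeal (K : Type*) [Field K] (n t c : ℕ) : Ideal (MvPolynomial (Fin n) K) :=
  Ideal.span ((fun j => monomial (pathExponent n t j) (1 : K)) '' Set.Iic c)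

theorem rowIdeal_succ (K : Type*) [Field K] (n t c : ℕ) :
    rowIdeal K n t (c + 1) =
      rowIdeal K n t c ⊔ Ideal.span {monomial (pathExponent n t (c + 1)) (1 : K)} := by
  rw [rowIdeal, rowIdeal, ← Ideal.span_union,
    ← Set.image_singleton (f := fun j => monomial (pathExponent n t j) (1 : K)), ← Set.image_union]
  congr 2
  ext j
  simp only [Set.mem_Iic, Set.union_singleton, Set.mem_insert_iff]
  omega

/-- The combinatorial heart of the argument: a product of `s + 1` of the first `c + 1` path
monomials and the next path monomial both divide a monomial only if that monomial is divisible by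
`x_c`, the next path monomial and a product of `s` of the first `c + 1` path monomials. The factor
to be left out is the one that starts last. It is used here that the first `c + 1` paths all
contain the vertex `c`, which needs `c < t`. -/
theorem exists_sum_pathExponent_le {n t c s : ℕ} (hc : c < t) (hn : c < n) {a : Multiset ℕ}
    (ha : a.card = s + 1) (hac : ∀ j ∈ a, j ≤ c) {e : Fin n →₀ ℕ}
    (h1 : (a.map (pathExponent n t)).sum ≤ e) (h2 : pathExponent n t (c + 1) ≤ e) :
    ∃ a' : Multiset ℕ, a'.card = s ∧ (∀ j ∈ a', j ≤ c) ∧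
      Finsupp.single ⟨c, hn⟩ 1 + pathExponent n t (c + 1) +
        (a'.map (pathExponent n t)).sum ≤ e := by
  have hne : a.toFinset.Nonempty := by
    rw [Multiset.toFinset_nonempty]
    rintro rfl
    simp at ha
  obtain ⟨m, hm, hmax⟩ := a.toFinset.exists_max_image id hne
  obtain ⟨a', rfl⟩ := Multiset.exists_cons_of_mem (Multiset.mem_toFinset.1 hm)
  simp only [Multiset.mem_toFinset, id, Multiset.mem_cons] at hmax
  refine ⟨a', by simpa using ha, fun j hj => hac j (Multiset.mem_cons_of_mem hj), fun p => ?_⟩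
  have hmc := hac m (Multiset.mem_cons_self _ _)
  have h1p := h1 p
  have h2p := h2 p
  rw [Multiset.map_cons, Multiset.sum_cons, Finsupp.add_apply] at h1p
  rw [Finsupp.add_apply, Finsupp.add_apply]
  have hsingle : (Finsupp.single (⟨c, hn⟩ : Fin n) 1) p = if (p : ℕ) = c then 1 else 0 := by
    rw [Finsupp.single_apply]
    exact if_congr ⟨fun h => h ▸ rfl, fun h => Fin.ext h.symm⟩ rfl rfl
  by_cases hp : (p : ℕ) < m + t
  · rw [hsingle]
    rw [pathExponent_apply] at h1p h2p ⊢
    split_ifs at * <;> omega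
  · -- no path of the product reaches `p`, since all of them start at `m` or before
    have h0 : (a'.map (pathExponent n t)).sum p = 0 := by
      rw [← Finsupp.applyAddHom_apply, map_multiset_sum, Multiset.map_map]
      refine Multiset.sum_eq_zero fun x hx => ?_
      obtain ⟨j, hj, rfl⟩ := Multiset.mem_map.1 hx
      have := hmax j (Or.inr hj)
      simp only [Function.comp, Finsupp.applyAddHom_apply, pathExponent_apply]
      rw [if_neg (by omega)]
    rw [hsingle, if_neg (by omega), h0]
    omega

/-- The intersection along which the mapping cone is formed. -/
theorem rowIdeal_pow_inf (K : Type*) [Field K] {n t c : ℕ} (s : ℕ) (hc : c + 1 ≤ t)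
    (hn : c + 1 + t ≤ n) :
    rowIdeal K n t c ^ (s + 1) ⊓
        Ideal.span {monomial (pathExponent n t (c + 1)) (1 : K)} * rowIdeal K n t (c + 1) ^ s =
      Ideal.span {monomial (Finsupp.single ⟨c, by omega⟩ 1 + pathExponent n t (c + 1)) (1 : K)} *
        rowIdeal K n t c ^ s := by
  refine le_antisymm ?_ (le_inf ?_ ?_)
  · rintro f ⟨hf1, hf2⟩
    replace hf2 := Ideal.mul_le_left (SetLike.mem_coe.1 hf2)
    rw [← Set.image_singleton (f := fun e => monomial e (1 : K)),
      mem_ideal_span_monomial_image] at hf2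
    rw [SetLike.mem_coe, rowIdeal, span_monomial_pow, mem_ideal_span_monomial_image] at hf1
    rw [rowIdeal, span_monomial_pow, Ideal.span_mul_span', Set.singleton_mul, Set.image_image]
    simp only [monomial_mul, mul_one]
    rw [← Set.image_image (fun e => monomial e (1 : K)), mem_ideal_span_monomial_image]
    intro e he
    obtain ⟨_, ⟨a, ha, hac, rfl⟩, h1⟩ := hf1 e he
    obtain ⟨_, rfl, h2⟩ := hf2 e he
    obtain ⟨a', ha', hac', h⟩ := exists_sum_pathExponent_le (by omega) (by omega) ha hac h1 h2
    exact ⟨_, ⟨_, ⟨a', ha', hac', rfl⟩, rfl⟩, h⟩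
  · -- `x_c` times the path starting at `c + 1` is the path starting at `c` times `x_{c+t}`
    rw [pow_succ' _ s]
    refine Ideal.mul_mono_left ?_
    rw [Ideal.span_singleton_le_iff_mem]
    have : Finsupp.single ⟨c, by omega⟩ 1 + pathExponent n t (c + 1) =
        Finsupp.single ⟨c + t, by omega⟩ 1 + pathExponent n t c := by
      ext p
      simp only [Finsupp.add_apply, pathExponent_apply, Finsupp.single_apply, Fin.ext_iff]
      split_ifs <;> omega
    rw [this, ← mul_one (1 : K), ← monomial_mul]
    exact Ideal.mul_mem_left _ _ (Ideal.subset_span ⟨c, Set.mem_Iic.2 le_rfl, by simp⟩)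
  · refine Ideal.mul_mono ?_ (Ideal.pow_right_mono ?_ _)
    · rw [Ideal.span_singleton_le_iff_mem, ← mul_one (1 : K), ← monomial_mul]
      exact Ideal.mul_mem_left _ _ (Ideal.subset_span (by simp))
    · rw [rowIdeal_succ]
      exact le_sup_left

/-- The double induction on the number of paths and on the exponent. The case `c = 0` is a principal
ideal, the case `s = 0` the unit ideal. -/
theorem nonempty_linearResolution_rowIdeal (K : Type*) [Field K] {n t : ℕ} (c s : ℕ)
    (hc : c ≤ t) (hn : c + t ≤ n) :
    Nonempty (LinearResolution (rowIdeal K n t c ^ s) (s * t) (pathBetti c s)) := by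
  have hhom : ∀ j, j + t ≤ n → (monomial (pathExponent n t j) (1 : K)).IsHomogeneous t :=
    fun j hj => isHomogeneous_monomial _ (degree_pathExponent hj)
  have hne : ∀ e : Fin n →₀ ℕ, monomial e (1 : K) ≠ 0 := fun e => by simp
  induction c generalizing s with
  | zero =>
    have h : rowIdeal K n t 0 ^ s =
        Ideal.span {monomial (pathExponent n t 0) (1 : K) ^ s} := by
      rw [rowIdeal, ← Ideal.span_singleton_pow]
      congr 2
      ext f
      simp [eq_comm]
    rw [h, funext (pathBetti_zero_left s), mul_comm]
    exact ⟨.ofSpanSingleton (pow_ne_zero _ (hne _)) ((hhom 0 hn).pow s)⟩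
  | succ c ihc =>
    induction s with
    | zero =>
      rw [funext (pathBetti_zero_right (c + 1)), pow_zero, zero_mul, Ideal.one_eq_top,
        ← Ideal.span_singleton_one]
      exact ⟨.ofSpanSingleton one_ne_zero (isHomogeneous_one _ _)⟩
    | succ s ihs =>
      obtain ⟨F⟩ := ihc (s + 1) (by omega) (by omega)
      obtain ⟨F'⟩ := ihs
      obtain ⟨G⟩ := ihc s (by omega) (by omega)
      have F₁ := F'.smul (hne (pathExponent n t (c + 1))) (hhom _ hn)
      have G₁ := G.smul
        (hne (Finsupp.single ⟨c, by omega⟩ 1 + pathExponent n t (c + 1))) (e := t + 1)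
        (isHomogeneous_monomial _ (by
          rw [map_add, degree_pathExponent hn, Finsupp.degree_single, add_comm]))
      rw [show t + s * t = (s + 1) * t by ring] at F₁
      rw [show t + 1 + s * t = (s + 1) * t + 1 by ring] at G₁
      rw [funext (pathBetti_succ_succ c s), rowIdeal_succ, Ideal.sup_pow_succ, ← rowIdeal_succ]
      exact F.nonempty_sup F₁ G₁ (rowIdeal_pow_inf K s hc hn)

/-! ### Generators of the path ideal -/

/-- Consecutive values of a path in a path graph always move in the same direction. -/
theorem SimpleGraph.pathGraph_path_monotone_or_antitone {n t : ℕ} {p : Fin t → Fin n}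
    (hp : Function.Injective p)
    (hadj : ∀ i j : Fin t, (i : ℕ) + 1 = j → (SimpleGraph.pathGraph n).Adj (p i) (p j))
    (ht : 0 < t) :
    (∀ i : Fin t, (p i : ℕ) = p ⟨0, ht⟩ + i) ∨ ∀ i : Fin t, (p i : ℕ) + i = p ⟨0, ht⟩ := by
  have hstep : ∀ i (hi : i + 1 < t), (p ⟨i, by omega⟩ : ℕ) + 1 = p ⟨i + 1, hi⟩ ∨
      (p ⟨i + 1, hi⟩ : ℕ) + 1 = p ⟨i, by omega⟩ := fun i hi =>
    SimpleGraph.pathGraph_adj.1 (hadj ⟨i, by omega⟩ ⟨i + 1, hi⟩ rfl)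
  have hback : ∀ i (hi : i + 1 + 1 < t), (p ⟨i + 1 + 1, hi⟩ : ℕ) ≠ p ⟨i, by omega⟩ := fun i hi h => by
    have := congrArg Fin.val (hp (Fin.ext h))
    dsimp only at this
    omega
  by_cases h1 : 1 < t
  · rcases hstep 0 h1 with h | h
    · left
      have key : ∀ i (hi : i + 1 < t), (p ⟨i, by omega⟩ : ℕ) = p ⟨0, ht⟩ + i ∧
          (p ⟨i + 1, hi⟩ : ℕ) = p ⟨0, ht⟩ + (i + 1) := by
        intro i
        induction i with
        | zero => exact fun _ => ⟨rfl, h.symm⟩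
        | succ i ih =>
          intro hi
          have h1 := ih (by omega)
          have h2 := hstep (i + 1) hi
          have h3 := hback i hi
          exact ⟨h1.2, by rcases h2 with h2 | h2 <;> omega⟩
      rintro ⟨i, hi⟩
      cases i with
      | zero => rfl
      | succ i => exact (key i hi).2
    · right
      have key : ∀ i (hi : i + 1 < t), (p ⟨i, by omega⟩ : ℕ) + i = p ⟨0, ht⟩ ∧
          (p ⟨i + 1, hi⟩ : ℕ) + (i + 1) = p ⟨0, ht⟩ := by
        intro i
        induction i with
        | zero => exact fun _ => ⟨rfl, h⟩
        | succ i ih =>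
          intro hi
          have h1 := ih (by omega)
          have h2 := hstep (i + 1) hi
          have h3 := hback i hi
          exact ⟨h1.2, by rcases h2 with h2 | h2 <;> omega⟩
      rintro ⟨i, hi⟩
      cases i with
      | zero => rfl
      | succ i => exact (key i hi).2
  · left
    rintro ⟨i, hi⟩
    obtain rfl : i = 0 := by omega
    rfl

theorem prod_X_eq_monomial_pathExponent (K : Type*) [Field K] {n t j : ℕ} {p : Fin t → Fin n}
    (hp : Function.Injective p)
    (hj : ∀ q : Fin n, (∃ i, p i = q) ↔ j ≤ (q : ℕ) ∧ (q : ℕ) < j + t) :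
    ∏ i, X (p i) = monomial (pathExponent n t j) (1 : K) := by
  have h : pathExponent n t j = ∑ i, Finsupp.single (p i) 1 := by
    ext q
    rw [pathExponent_apply, Finsupp.finsetSum_apply]
    split_ifs with h
    · obtain ⟨i, rfl⟩ := (hj q).2 h
      simp [Finsupp.single_apply, hp.eq_iff]
    · refine (Finset.sum_eq_zero fun i _ => ?_).symm
      exact Finsupp.single_eq_of_ne' fun hi => h ((hj q).1 ⟨i, hi⟩)
  rw [h, monomial_sum_one]
  rfl

theorem pathIdeal_pathGraph (K : Type*) [Field K] {n t : ℕ} (ht : 1 ≤ t) (htn : t ≤ n) :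
    pathIdeal K (SimpleGraph.pathGraph n) t = rowIdeal K n t (n - t) := by
  refine le_antisymm (Ideal.span_le.2 ?_) (Ideal.span_le.2 ?_)
  · rintro _ ⟨p, hp, hadj, rfl⟩
    have h : ∃ j, j + t ≤ n ∧
        ∀ q : Fin n, (∃ i, p i = q) ↔ j ≤ (q : ℕ) ∧ (q : ℕ) < j + t := by
      rcases SimpleGraph.pathGraph_path_monotone_or_antitone hp hadj ht with h | h
      · have h1 := h ⟨t - 1, by omega⟩
        refine ⟨p ⟨0, ht⟩, by dsimp only at h1; omega, fun q => ⟨?_, fun hq => ?_⟩⟩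
        · rintro ⟨i, rfl⟩
          have := h i
          omega
        · refine ⟨⟨q - p ⟨0, ht⟩, by omega⟩, Fin.ext ?_⟩
          rw [h]
          dsimp only
          omega
      · have h1 := h ⟨t - 1, by omega⟩
        refine ⟨p ⟨t - 1, by omega⟩, by dsimp only at h1; omega, fun q => ⟨?_, fun hq => ?_⟩⟩
        · rintro ⟨i, rfl⟩
          have := h i
          dsimp only at h1
          omega
        · dsimp only at h1
          have h2 := h ⟨p ⟨0, ht⟩ - q, by omega⟩
          exact ⟨⟨p ⟨0, ht⟩ - q, by omega⟩, Fin.ext (by dsimp only at h2; omega)⟩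
    obtain ⟨j, hjn, hj⟩ := h
    rw [prod_X_eq_monomial_pathExponent K hp hj]
    exact Ideal.subset_span ⟨j, Set.mem_Iic.2 (by omega), rfl⟩
  · rintro _ ⟨j, hj, rfl⟩
    rw [Set.mem_Iic] at hj
    refine Ideal.subset_span ⟨fun i => ⟨j + i, by omega⟩, fun i k hik => ?_, fun i k hik => ?_, ?_⟩
    · have := congrArg Fin.val hik
      dsimp only at this
      exact Fin.ext (by omega)
    · rw [SimpleGraph.pathGraph_adj]
      dsimp only
      omega
    · refine (prod_X_eq_monomial_pathExponent K (fun i k hik => ?_) fun q => ⟨?_, fun hq => ?_⟩).symm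
      · have := congrArg Fin.val hik
        dsimp only at this
        exact Fin.ext (by omega)
      · rintro ⟨i, rfl⟩
        dsimp only
        omega
      · exact ⟨⟨q - j, by omega⟩, Fin.ext (by dsimp only; omega)⟩

/-! ### Uniqueness of minimal graded resolutions -/

namespace MinimalGradedFreeResolution

variable {K : Type*} [Field K] {V : Type*} {J : Ideal (MvPolynomial V K)}

theorem constantCoeff_apply {α β : Type*} [Fintype α] [DecidableEq α]
    (f : (α → MvPolynomial V K) →ₗ[MvPolynomial V K] (β → MvPolynomial V K)) (x) (b : β) :
    constantCoeff (f x b) =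
      ∑ a, constantCoeff (x a) * constantCoeff (f (Pi.single a 1) b) := by
  rw [LinearMap.apply_eq_sum_single, Finset.sum_apply, map_sum]
  simp only [Pi.smul_apply, smul_eq_mul, map_mul]

/-- The comparison theorem, in its graded form: the identity of `J` lifts to a chain map of degree
zero between two resolutions. -/
theorem exists_comparison (F G : MinimalGradedFreeResolution J) :
    ∃ φ : ∀ i, (Fin (F.rk i) → MvPolynomial V K) →ₗ[MvPolynomial V K]
        (Fin (G.rk i) → MvPolynomial V K),
      (∀ x, G.aug (φ 0 x) = F.aug x) ∧ (∀ i x, G.d i (φ (i + 1) x) = φ i (F.d i x)) ∧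
      ∀ i b a, ∀ m ∈ (φ i (Pi.single b 1) a).support, m.degree + G.deg i a = F.deg i b := by
  obtain ⟨φ₀, hP, h₀⟩ := LinearMap.exists_lift_of_single F.aug G.aug
    (fun b y => ∀ a, ∀ m ∈ (y a).support, m.degree + G.deg 0 a = F.deg 0 b) (by
      intro b
      have hF : F.aug (Pi.single b 1) ∈ LinearMap.range G.aug := by
        exact (G.range_aug.trans F.range_aug.symm).ge (LinearMap.mem_range_self _ _)
      obtain ⟨y, hy⟩ := hF
      obtain ⟨x, hx1, hx2⟩ := exists_graded_solution (κ := Unit)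
        (M := fun _ a => G.aug (Pi.single a 1)) (δ := fun _ => 0) (ε := G.deg 0)
        (y := fun _ => F.aug (Pi.single b 1)) (e := F.deg 0 b)
        (fun _ a m hm => isHomogeneous_iff_degree.1 (G.aug_homogeneous a) m hm)
        (fun _ m hm => isHomogeneous_iff_degree.1 (F.aug_homogeneous b) m hm)
        ⟨y, fun _ => by
          rw [← hy, LinearMap.apply_eq_sum_single]
          simp only [smul_eq_mul, mul_comm]⟩
      refine ⟨x, hx1, ?_⟩
      rw [LinearMap.apply_eq_sum_single, ← hx2 ()]
      simp only [smul_eq_mul, mul_comm])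
  obtain ⟨φ, h0, hQ, hr⟩ := exists_seq_of_forall_exists
    (X := fun i => (Fin (F.rk i) → MvPolynomial V K) →ₗ[MvPolynomial V K]
        (Fin (G.rk i) → MvPolynomial V K))
    (fun i φ => (∀ b a, ∀ m ∈ (φ (Pi.single b 1) a).support, m.degree + G.deg i a = F.deg i b) ∧
      ∀ x, ∃ y, G.d i y = φ (F.d i x))
    (fun i φ φ' => ∀ x, G.d i (φ' x) = φ (F.d i x))
    φ₀ ⟨hP, fun x => (G.exact_aug _).1 (by rw [h₀, F.exact_aug.apply_apply_eq_zero])⟩ (by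
      rintro i φ ⟨hφ, hφd⟩
      obtain ⟨ψ, hψ, hψd⟩ := LinearMap.exists_lift_of_single (φ ∘ₗ F.d i) (G.d i)
        (fun b y => ∀ a, ∀ m ∈ (y a).support, m.degree + G.deg (i + 1) a = F.deg (i + 1) b) (by
          intro b
          obtain ⟨y, hy⟩ := hφd (Pi.single b 1)
          obtain ⟨x, hx1, hx2⟩ := exists_graded_solution
            (M := fun c a => G.d i (Pi.single a 1) c) (δ := G.deg i) (ε := G.deg (i + 1))
            (y := φ (F.d i (Pi.single b 1))) (e := F.deg (i + 1) b)
            (fun c a m hm => G.d_homogeneous i a c m hm)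
            (fun c m hm => by
              rw [LinearMap.apply_eq_sum_single φ, Finset.sum_apply] at hm
              obtain ⟨k, m₁, h₁, m₂, h₂, rfl⟩ := exists_add_eq_of_mem_support_sum_mul hm
              have e₁ := F.d_homogeneous i b k m₁ h₁
              have e₂ := hφ k c m₂ h₂
              rw [map_add]
              omega)
            ⟨y, fun c => by
              rw [← hy, LinearMap.apply_eq_sum_single (G.d i) y, Finset.sum_apply]
              simp only [Pi.smul_apply, smul_eq_mul, mul_comm]⟩
          refine ⟨x, hx1, funext fun c => ?_⟩
          rw [LinearMap.apply_eq_sum_single (G.d i) x, Finset.sum_apply, LinearMap.comp_apply,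
            ← hx2 c]
          simp only [Pi.smul_apply, smul_eq_mul, mul_comm])
      refine ⟨ψ, ⟨hψ, fun x => ?_⟩, hψd⟩
      refine (G.exact_d i _).1 ?_
      rw [hψd, LinearMap.comp_apply, (F.exact_d i).apply_apply_eq_zero, map_zero])
  exact ⟨φ, h0 ▸ h₀, hr, fun i => (hQ i).1⟩

/-- A chain endomorphism of a minimal resolution which lifts the identity is the identity modulo
the variables: it is homotopic to the identity, and the entries of a null-homotopic map have no
constant term. -/
theorem constantCoeff_endomorphism (F : MinimalGradedFreeResolution J)
    (θ : ∀ i, (Fin (F.rk i) → MvPolynomial V K) →ₗ[MvPolynomial V K]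
      (Fin (F.rk i) → MvPolynomial V K))
    (h₀ : ∀ x, F.aug (θ 0 x) = F.aug x) (h : ∀ i x, F.d i (θ (i + 1) x) = θ i (F.d i x))
    (i : ℕ) (x a) : constantCoeff (θ i x a) = constantCoeff (x a) := by
  suffices key : ∀ i, (∀ x a, constantCoeff ((θ i x - x) a) = 0) ∧
      ∃ η : (Fin (F.rk i) → MvPolynomial V K) →ₗ[MvPolynomial V K]
        (Fin (F.rk (i + 1)) → MvPolynomial V K),
        ∀ x, F.d i (θ (i + 1) x - x - η (F.d i x)) = 0 by
    simpa [sub_eq_zero] using (key i).1 x a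
  clear i x a
  intro i
  induction i with
  | zero =>
    obtain ⟨η, -, hη⟩ := LinearMap.exists_lift_of_single (θ 0 - LinearMap.id) (F.d 0)
      (fun _ _ => True) (fun b => by
        have h1 : F.aug (θ 0 (Pi.single b 1) - Pi.single b 1) = 0 := by
          rw [map_sub, h₀, sub_self]
        obtain ⟨y, hy⟩ := (F.exact_aug _).1 h1
        exact ⟨y, trivial, hy⟩)
    simp only [LinearMap.sub_apply, LinearMap.id_apply] at hη
    refine ⟨fun x a => by rw [← hη, F.minimal], η, fun x => ?_⟩
    rw [map_sub, map_sub, hη, h, sub_self]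
  | succ i ih =>
    obtain ⟨-, η, hη⟩ := ih
    obtain ⟨η', -, hη'⟩ := LinearMap.exists_lift_of_single
      (θ (i + 1) - LinearMap.id - η ∘ₗ F.d i) (F.d (i + 1))
      (fun _ _ => True) (fun b => by
        obtain ⟨y, hy⟩ := (F.exact_d i _).1 (hη (Pi.single b 1))
        exact ⟨y, trivial, hy⟩)
    simp only [LinearMap.sub_apply, LinearMap.id_apply, LinearMap.comp_apply] at hη'
    refine ⟨fun x a => ?_, η', fun x => ?_⟩
    · rw [← sub_add_cancel (θ (i + 1) x - x) (η (F.d i x)), ← hη', Pi.add_apply, map_add,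
        F.minimal, zero_add, constantCoeff_apply]
      simp only [F.minimal, zero_mul, Finset.sum_const_zero]
    · rw [map_sub, map_sub, hη', h, (F.exact_d i).apply_apply_eq_zero, map_zero, sub_zero,
        sub_self]

/-- Comparison maps between two minimal resolutions reduce, modulo the variables, to mutually
inverse matrices over the field, with nonzero entries only in places where the degrees agree. -/
theorem exists_inverse_matrices (F G : MinimalGradedFreeResolution J) (i : ℕ) :
    ∃ (M : Matrix (Fin (G.rk i)) (Fin (F.rk i)) K) (N : Matrix (Fin (F.rk i)) (Fin (G.rk i)) K),
      M * N = 1 ∧ N * M = 1 ∧ (∀ a b, M a b ≠ 0 → G.deg i a = F.deg i b) ∧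
      ∀ b a, N b a ≠ 0 → F.deg i b = G.deg i a := by
  obtain ⟨φ, hφ0, hφ, hφdeg⟩ := exists_comparison F G
  obtain ⟨ψ, hψ0, hψ, hψdeg⟩ := exists_comparison G F
  refine ⟨of fun a b => constantCoeff (φ i (Pi.single b 1) a),
    of fun b a => constantCoeff (ψ i (Pi.single a 1) b), ?_, ?_, fun a b h => ?_, fun b a h => ?_⟩
  · ext a a'
    have := G.constantCoeff_endomorphism (fun i => φ i ∘ₗ ψ i) (fun x => by simp [hφ0, hψ0])
      (fun i x => by simp [hφ, hψ]) i (Pi.single a' 1) a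
    rw [LinearMap.comp_apply, constantCoeff_apply] at this
    rw [mul_apply, one_apply]
    simp only [of_apply, mul_comm] at this ⊢
    rw [this, Pi.single_apply]
    split_ifs <;> simp
  · ext b b'
    have := F.constantCoeff_endomorphism (fun i => ψ i ∘ₗ φ i) (fun x => by simp [hφ0, hψ0])
      (fun i x => by simp [hφ, hψ]) i (Pi.single b' 1) b
    rw [LinearMap.comp_apply, constantCoeff_apply] at this
    rw [mul_apply, one_apply]
    simp only [of_apply, mul_comm] at this ⊢
    rw [this, Pi.single_apply]
    split_ifs <;> simp
  · simpa using hφdeg i b a 0 (mem_support_iff.2 h)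
  · simpa using hψdeg i a b 0 (mem_support_iff.2 h)

theorem betti_eq (F G : MinimalGradedFreeResolution J) (i : ℕ) : F.betti i = G.betti i := by
  obtain ⟨M, N, h₁, h₂, -⟩ := exists_inverse_matrices F G i
  simpa [betti] using Matrix.square_of_invertible N M h₂ h₁

theorem gradedBetti_eq (F G : MinimalGradedFreeResolution J) (i j : ℕ) :
    F.gradedBetti i j = G.gradedBetti i j := by
  obtain ⟨M, N, h₁, h₂, hM, hN⟩ := exists_inverse_matrices F G i
  -- the blocks of degree `j` are inverse to each other as well
  have key : ∀ {α β : Type} [Fintype α] [Fintype β] [DecidableEq α] [DecidableEq β]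
      (d : α → ℕ) (e : β → ℕ) (M : Matrix α β K) (N : Matrix β α K), M * N = 1 →
      (∀ b a, N b a ≠ 0 → e b = d a) →
      M.submatrix (Subtype.val : {a // d a = j} → α) (Subtype.val : {b // e b = j} → β) *
        N.submatrix (Subtype.val : {b // e b = j} → β) (Subtype.val : {a // d a = j} → α) = 1 := by
    intro α β _ _ _ _ d e M N h hN
    ext a a'
    have h' := congrFun (congrFun h a) a'
    rw [mul_apply] at h'
    rw [mul_apply, one_apply]
    simp only [Subtype.ext_iff, ← one_apply, ← h', submatrix_apply]
    rw [← Finset.sum_subtype (Finset.univ.filter fun b => e b = j) (by simp)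
      (fun b => M a b * N b a')]
    exact Finset.sum_filter_of_ne fun b _ hb => (hN b a' (right_ne_zero_of_mul hb)).trans a'.2
  have := Matrix.square_of_invertible _ _ (key (F.deg i) (G.deg i) N M h₂ hM)
    (key (G.deg i) (F.deg i) M N h₁ hN)
  simpa only [Fintype.card_subtype, gradedBetti] using this

end MinimalGradedFreeResolution

/-! ### Projective dimension -/

namespace ModuleCat

variable {R : Type u} [CommRing R] {P : ℕ → Type u} [∀ i, AddCommGroup (P i)]
  [∀ i, Module R (P i)] (f : ∀ i, P (i + 1) →ₗ[R] P i)

/-- In an exact complex of projective modules, passing from one cokernel to the next lowers the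
projective dimension by one, until it reaches a projective module. -/
theorem hasProjectiveDimensionLT_coker_iff [∀ i, Module.Projective R (P i)]
    (hf : ∀ i, Function.Exact (f (i + 1)) (f i)) (q i : ℕ) :
    HasProjectiveDimensionLT (of R (P i ⧸ LinearMap.range (f i))) (q + 1) ↔
      Module.Projective R (P (i + q) ⧸ LinearMap.range (f (i + q))) := by
  induction q generalizing i with
  | zero =>
    rw [zero_add, ← projective_iff_hasProjectiveDimensionLT_one]
    exact (IsProjective.iff_projective _).symm
  | succ q ih =>
    have hker : LinearMap.ker (f i) = LinearMap.range (f (i + 1)) := (hf i).linearMap_ker_eq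
    let g : (P (i + 1) ⧸ LinearMap.range (f (i + 1))) →ₗ[R] P i :=
      (LinearMap.range (f (i + 1))).liftQ (f i) hker.ge
    have hg : LinearMap.range g = LinearMap.range (f i) := Submodule.range_liftQ _ _ _
    let S : ShortComplex (ModuleCat.{u} R) :=
      ShortComplex.mk (X₁ := of R (P (i + 1) ⧸ LinearMap.range (f (i + 1)))) (X₂ := of R (P i))
        (X₃ := of R (P i ⧸ LinearMap.range (f i))) (ofHom g)
        (ofHom (LinearMap.range (f i)).mkQ) (by
          refine hom_ext (LinearMap.ext fun x => ?_)
          exact (Submodule.Quotient.mk_eq_zero _).2 (hg ▸ LinearMap.mem_range_self g x))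
    have hS : S.ShortExact := by
      refine shortComplex_shortExact S ?_ ?_ ?_
      · rw [LinearMap.exact_iff]
        exact (Submodule.ker_mkQ _).trans hg.symm
      · refine (LinearMap.ker_eq_bot (f := g)).1 ?_
        rw [Submodule.ker_liftQ_eq_bot _ _ _ hker.le]
      · exact Submodule.mkQ_surjective _
    have h2 : Projective S.X₂ := (IsProjective.iff_projective (R := R) (P i)).1 inferInstance
    rw [show i + (q + 1) = i + 1 + q by omega, ← ih (i + 1)]
    exact hS.hasProjectiveDimensionLT_X₃_iff q h2

end ModuleCat

namespace MinimalGradedFreeResolution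

variable {K : Type u} [Field K] {V : Type v} {J : Ideal (MvPolynomial V K)}

/-- The ranks of a resolution of `J`, continued to a resolution of `R ⧸ J` by `R` itself. -/
def augRk (F : MinimalGradedFreeResolution J) : ℕ → ℕ
  | 0 => 1
  | i + 1 => F.rk i

/-- The differentials of the resolution of `R ⧸ J`; the first one is the augmentation. -/
noncomputable def augD (F : MinimalGradedFreeResolution J) :
    ∀ i, (Fin (F.augRk (i + 1)) → MvPolynomial V K) →ₗ[MvPolynomial V K]
      (Fin (F.augRk i) → MvPolynomial V K)
  | 0 => LinearMap.pi fun _ => F.aug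
  | i + 1 => F.d i

theorem exact_augD (F : MinimalGradedFreeResolution J) :
    ∀ i, Function.Exact (F.augD (i + 1)) (F.augD i)
  | 0 => fun x =>
    Iff.trans ⟨fun h => congrFun h (0 : Fin 1), fun h => funext fun _ => h⟩ (F.exact_aug x)
  | i + 1 => F.exact_d i

/-- The projective dimension of `R ⧸ J`, for a proper ideal `J`, is the length of a minimal
resolution: if it were smaller, the last differential would split, but modulo the variables this
differential is zero. -/
theorem projectiveDimension_quotient (F : MinimalGradedFreeResolution J)
    (hJ : ∀ f ∈ J, constantCoeff f = 0) {L : ℕ} (hL : F.rk L ≠ 0) (hL' : F.rk (L + 1) = 0) :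
    projectiveDimension (ModuleCat.of (MvPolynomial V K) (MvPolynomial V K ⧸ J)) =
      ((L + 1 : ℕ) : WithBot ℕ∞) := by
  have e : ((Fin 1 → MvPolynomial V K) ⧸ LinearMap.range (F.augD 0)) ≃ₗ[MvPolynomial V K]
      (MvPolynomial V K ⧸ J) :=
    Submodule.Quotient.equiv _ _ (LinearEquiv.funUnique (Fin 1) _ _) (by
      refine (LinearMap.range_comp _ _).symm.trans (Eq.trans ?_ F.range_aug)
      rfl)
  rw [← projectiveDimension_eq_of_iso e.toModuleIso]
  have hmin : ∀ i x a, constantCoeff (F.augD i x a) = 0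
    | 0, x, _ => hJ _ (F.range_aug.le (LinearMap.mem_range_self F.aug x))
    | i + 1, x, a => F.minimal i x a
  have hsub : Subsingleton (Fin (F.augRk (L + 2)) → MvPolynomial V K) := by
    have : IsEmpty (Fin (F.augRk (L + 2))) := by
      change IsEmpty (Fin (F.rk (L + 1)))
      rw [hL']
      infer_instance
    infer_instance
  have hrange : LinearMap.range (F.augD (L + 1)) = ⊥ := by
    rw [LinearMap.range_eq_bot]
    refine LinearMap.ext fun x => ?_
    rw [Subsingleton.elim x 0, map_zero, map_zero]
  have hinj : Function.Injective (F.augD L) := by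
    rw [← LinearMap.ker_eq_bot, (F.exact_augD L).linearMap_ker_eq, hrange]
  refine le_antisymm ?_ ?_
  · rw [projectiveDimension_le_iff]
    refine (ModuleCat.hasProjectiveDimensionLT_coker_iff (P := fun i => Fin (F.augRk i) → MvPolynomial V K)
      F.augD F.exact_augD (L + 1) 0).2 ?_
    rw [zero_add, hrange]
    exact Module.Projective.of_equiv (Submodule.quotEquivOfEqBot _ rfl).symm
  · rw [projectiveDimension_ge_iff]
    intro h
    replace h := (ModuleCat.hasProjectiveDimensionLT_coker_iff
      (P := fun i => Fin (F.augRk i) → MvPolynomial V K) F.augD F.exact_augD L 0).1 h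
    rw [zero_add] at h
    obtain ⟨σ, hσ⟩ := Module.projective_lifting_property (LinearMap.range (F.augD L)).mkQ
      LinearMap.id (Submodule.mkQ_surjective _)
    -- a retraction of the last differential
    obtain ⟨τ, -, hτ⟩ := LinearMap.exists_lift_of_single
      (LinearMap.id - σ ∘ₗ (LinearMap.range (F.augD L)).mkQ) (F.augD L) (fun _ _ => True)
      (fun b => by
        suffices h : Pi.single b 1 - σ ((LinearMap.range (F.augD L)).mkQ (Pi.single b 1)) ∈
            LinearMap.range (F.augD L) by
          obtain ⟨y, hy⟩ := h
          exact ⟨y, trivial, hy⟩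
        refine (Submodule.ker_mkQ (LinearMap.range (F.augD L))).le ?_
        rw [LinearMap.mem_ker, map_sub, ← LinearMap.comp_apply, hσ, LinearMap.id_apply, sub_self])
    have hret : ∀ y, τ (F.augD L y) = y := fun y => hinj (by
      have h0 : (LinearMap.range (F.augD L)).mkQ (F.augD L y) = 0 :=
        (Submodule.Quotient.mk_eq_zero _).2 (LinearMap.mem_range_self _ _)
      rw [hτ, LinearMap.sub_apply, LinearMap.comp_apply, h0, map_zero, sub_zero,
        LinearMap.id_apply])
    let b : Fin (F.augRk (L + 1)) := ⟨0, Nat.pos_of_ne_zero hL⟩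
    have h1 : constantCoeff (τ (F.augD L (Pi.single b 1)) b) = 0 := by
      rw [constantCoeff_apply]
      simp only [hmin, zero_mul, Finset.sum_const_zero]
    rw [hret, Pi.single_eq_same, map_one] at h1
    exact one_ne_zero h1

end MinimalGradedFreeResolution

/-! ### Betti numbers of the powers of the path ideal -/

/-- The Betti numbers of the ideal `I_t(L_n)^s` are read off from its minimal graded free
resolutions: one exists, and all of them have the stated ranks and degrees. -/
theorem corollary2p3 (K : Type*) [Field K] (n t s : ℕ) (ht : 1 ≤ t) (hs : 1 ≤ s)
    (htn : t ≤ n) (hnt : n ≤ 2 * t) :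
    Nonempty (MinimalGradedFreeResolution (pathIdeal K (SimpleGraph.pathGraph n) t ^ s)) ∧
    (∀ F : MinimalGradedFreeResolution (pathIdeal K (SimpleGraph.pathGraph n) t ^ s), ∀ i : ℕ,
      F.betti i =
        ∑ k ∈ Finset.Icc i (n - t), (n - t).choose k * s.choose k * k.choose i ∧
      F.gradedBetti i (i + s * t) =
        ∑ k ∈ Finset.Icc i (n - t), (n - t).choose k * s.choose k * k.choose i ∧
      ∀ j : ℕ, j ≠ i + s * t → F.gradedBetti i j = 0) ∧
    projectiveDimension (ModuleCat.of (MvPolynomial (Fin n) K)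
        (MvPolynomial (Fin n) K ⧸ pathIdeal K (SimpleGraph.pathGraph n) t ^ s)) =
      ((min (n - t + 1) (s + 1) : ℕ) : WithBot ℕ∞) := by
  rw [pathIdeal_pathGraph K ht htn]
  obtain ⟨R⟩ := nonempty_linearResolution_rowIdeal K (n := n) (n - t) s
    (by omega : n - t ≤ t) (by omega)
  have hrk : ∀ i, R.toMinimal.rk i = pathBetti (n - t) s i := fun _ => rfl
  refine ⟨⟨R.toMinimal⟩, fun F i => ⟨?_, ?_, fun j hj => ?_⟩, ?_⟩
  · rw [F.betti_eq R.toMinimal, ← pathBetti_eq_sum_Icc]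
    rfl
  · rw [F.gradedBetti_eq R.toMinimal, ← pathBetti_eq_sum_Icc]
    refine (congrArg Finset.card (Finset.filter_true_of_mem fun _ _ => rfl)).trans ?_
    exact Finset.card_fin _
  · rw [F.gradedBetti_eq R.toMinimal]
    exact Finset.card_eq_zero.2 (Finset.filter_false_of_mem fun _ _ h => hj h.symm)
  · rw [min_add_add_right]
    refine R.toMinimal.projectiveDimension_quotient (fun f hf => ?_) ?_ ?_
    · obtain ⟨x, rfl⟩ := (R.mem_iff f).1 hf
      rw [dotProduct, map_sum]
      refine Finset.sum_eq_zero fun b _ => ?_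
      have hst : s * t ≠ 0 := mul_ne_zero (by omega) (by omega)
      rw [map_mul, constantCoeff_eq, (R.aug_homogeneous b).coeff_eq_zero (by simpa using hst.symm),
        zero_mul]
    · rw [hrk, ← Nat.pos_iff_ne_zero, pathBetti_pos_iff]
      omega
    · rw [hrk, ← Nat.le_zero, ← not_lt, pathBetti_pos_iff]
      omega
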